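/- Let $X$ be a compact metrizable space and let $T:X\to 2^X$ be a multi-valued map with closed (possibly empty) values that is upper semi-continuous: for every $x\in X$ and every open $V\supseteq T(x)$ there is an open $U\ni x$ such that $T(u)\subseteq V$ for all $u\in U$. Put $$X_T=\{(x_i)_{i\in\mathbb Z}\in X^{\mathbb Z}: x_{i+1}\in T(x_i)\ \text{for all } i\in\mathbb Z\},$$ $$\mathcal O_n(T)=\{(x_0,\dots,x_n)\in X^{n+1}: x_{k+1}\in T(x_k)\ \text{for } 0\le k\le n-1\}\qquad(n\ge 0),$$ and let $\mathcal M_T$ be the set of Borel probability measures $\mu$ on $X$ that are $T$-invariant, i.e. $\mu(A)\le\mu(T^{-1}A)$ for every Borel set $A\subseteq X$, where $T^{-1}A=\{x\in X: T(x)\cap A\neq\emptyset\}$ (the set $T^{-1}A$ is analytic, and is measured by the completion of $\mu$). Let $f:X\to\mathbb R$ be upper semi-continuous, and write $S_nf=\sum_{k=0}^n f(x_k)$, both for $(x_i)_{i\in\mathbb Z}\in X_T$ and for $(x_0,\dots,x_n)\in\mathcal O_n(T)$. Let $\operatorname{Reg}(T,f)$ be the set of $\underline x\in X_T$ for which $\lim_{n\to\infty}\frac1{n+1}S_nf(\underline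 x)$ exists in $[-\infty,\infty]$. With the convention $\sup\emptyset=-\infty$, and with $\int f\,d\mu=\int f^+\,d\mu-\int f^-\,d\mu\in[-\infty,\infty)$, define $$\alpha(f)=\sup_{\mu\in\mathcal M_T}\int f\,d\mu,\qquad \beta(f)=\sup_{\underline x\in\operatorname{Reg}(T,f)}\ \lim_{n\to\infty}\tfrac1{n+1}S_nf(\underline x),\qquad \gamma(f)=\sup_{\underline x\in X_T}\ \limsup_{n\to\infty}\tfrac1{n+1}S_nf(\underline x),$$ $$\delta(f)=\limsup_{n\to\infty}\ \tfrac1{n+1}\sup_{(x_0,\dots,x_n)\in\mathcal O_n(T)}S_nf(x_0,\dots,x_n),\qquad \varepsilon(f)=\sup_{\underline x\in X_T}\ \inf_{n\ge 0}\tfrac1{n+1}S_nf(\underline x).$$ Then $$\alpha(f)=\beta(f)=\gamma(f)=\delta(f)=\varepsilon(f)\in[-\infty,+\infty).$$ If, moreover, $X_T\neq\emptyset$ and $f$ is bounded, then $\alpha(f)\in\mathbb R$. -/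

import Mathlib

open MeasureTheory Filter Topology

noncomputable section

namespace MultiValued

/-- The orbit space `X_T`: bi-infinite sequences with `x (i + 1) ∈ T (x i)` for every `i`. -/
def orbitSpace {X : Type*} (T : X → Set X) : Set (ℤ → X) :=
  {x | ∀ i : ℤ, x (i + 1) ∈ T (x i)}

/-- The set `O_n(T)` of finite orbit segments `(x_0, …, x_n)`. -/
def orbitSegments {X : Type*} (T : X → Set X) (n : ℕ) : Set (Fin (n + 1) → X) :=
  {x | ∀ k : Fin n, x k.succ ∈ T (x k.castSucc)}

/-- The preimage `T⁻¹(A) = {x | T(x) ∩ A ≠ ∅}`, that is, the union over `a ∈ A` of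
`T⁻¹(a) = {x | a ∈ T(x)}`. -/
def preimage {X : Type*} (T : X → Set X) (A : Set X) : Set X :=
  ⋃ a ∈ A, {x | a ∈ T x}

/-- A Borel measure `μ` is `T`-invariant if `μ(A) ≤ μ(T⁻¹ A)` for all Borel sets `A`.
For upper semi-continuous `T` with closed values, `T⁻¹ A` is analytic, and a measure in
Mathlib evaluates it by the completion of `μ`. -/
def IsInvariant {X : Type*} [MeasurableSpace X] (T : X → Set X) (μ : Measure X) : Prop :=
  ∀ A : Set X, MeasurableSet A → μ A ≤ μ (preimage T A)

/-- The set `M_T` of `T`-invariant Borel probability measures. -/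
def invariantMeasures {X : Type*} [MeasurableSpace X] (T : X → Set X) :
    Set (ProbabilityMeasure X) :=
  {μ | IsInvariant T (μ : Measure X)}

/-- The extended-real-valued integral `∫ f⁺ dμ - ∫ f⁻ dμ` of a Borel function `f`, meaningful
as soon as one of the two terms is finite, e.g. if `μ` is finite and `f` is bounded above
or below. -/
def extIntegral {X : Type*} [MeasurableSpace X] (f : X → ℝ) (μ : Measure X) : EReal :=
  ((∫⁻ x, ENNReal.ofReal (f x) ∂μ : ENNReal) : EReal)
    - ((∫⁻ x, ENNReal.ofReal (-f x) ∂μ : ENNReal) : EReal)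

/-- The time average `(1 / (n + 1)) S_n f (x)`, where `S_n f (x) = f(x_0) + ⋯ + f(x_n)`,
along a bi-infinite sequence. -/
def timeAverage {X : Type*} (f : X → ℝ) (x : ℤ → X) (n : ℕ) : EReal :=
  ((1 / ((n : ℝ) + 1) * ∑ k ∈ Finset.range (n + 1), f (x (k : ℤ)) : ℝ) : EReal)

/-- The set `Reg(T, f)` of orbits whose time averages converge in `[-∞, ∞]`. -/
def regularOrbits {X : Type*} (T : X → Set X) (f : X → ℝ) : Set (ℤ → X) :=
  {x | x ∈ orbitSpace T ∧ ∃ L : EReal, Tendsto (timeAverage f x) atTop (𝓝 L)}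

/-- `α(f)`: the supremum of `∫ f dμ` over all `T`-invariant probability measures. -/
def alpha {X : Type*} [MeasurableSpace X] (T : X → Set X) (f : X → ℝ) : EReal :=
  ⨆ μ ∈ invariantMeasures T, extIntegral f (μ : Measure X)

/-- `β(f)`: the supremum, over all regular orbits, of the limit of the time averages. -/
def beta {X : Type*} (T : X → Set X) (f : X → ℝ) : EReal :=
  sSup {L : EReal | ∃ x ∈ regularOrbits T f, Tendsto (timeAverage f x) atTop (𝓝 L)}

/-- `γ(f)`: the supremum, over all orbits, of the upper limit of the time averages. -/
def gamma {X : Type*} (T : X → Set X) (f : X → ℝ) : EReal :=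
  ⨆ x ∈ orbitSpace T, limsup (timeAverage f x) atTop

/-- `δ(f)`: the upper limit of the maximal averages over finite orbit segments. -/
def delta {X : Type*} (T : X → Set X) (f : X → ℝ) : EReal :=
  limsup (fun n : ℕ => ((1 / ((n : ℝ) + 1) : ℝ) : EReal) *
    ⨆ x ∈ orbitSegments T n, ((∑ k, f (x k) : ℝ) : EReal)) atTop

/-- `ε(f)`: the supremum, over all orbits, of the infimum of the time averages. -/
def epsilon {X : Type*} (T : X → Set X) (f : X → ℝ) : EReal :=
  ⨆ x ∈ orbitSpace T, ⨅ n : ℕ, timeAverage f x n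

end MultiValued

end

namespace MultiValued

/-! ### Closed graph, orbit space and semicontinuity. -/

section Topology

variable {X : Type*} [TopologicalSpace X]

/-! Everything is compared with δ and ε, through the cycle ε ≤ γ ≤ δ ≤ ε. The substantial inequality
δ ≤ ε (`delta_le_epsilon`) cuts long, nearly optimal segments at a minimum of their partial sums, so
that all averages after the cut are at least c; compactness then yields an orbit. By compactness
again, ε is attained; since γ ≤ ε, the averages along that orbit converge to γ, which gives γ ≤ β.

For α ≤ δ, choose M ≥ f and take M - f as a cost. Invariance says exactly that passing to the
cheapest successor does not increase the integral of a cost, so the optimal cost of n + 1 steps has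
integral at most (n + 1) ∫ (M - f) dμ, and some starting point does no worse than this mean. No
measurable selection is needed. For ε ≤ α, a Krylov–Bogolyubov limit of empirical measures is taken
on pairs of consecutive points: the limit lives on the closed graph and has equal marginals, and
this forces invariance of the marginal. -/

theorem isClosed_graph [RegularSpace X] {T : X → Set X} (hT : UpperHemicontinuous T)
    (hTclosed : ∀ x, IsClosed (T x)) : IsClosed {p : X × X | p.2 ∈ T p.1} := by
  rw [isClosed_iff_forall_filter]
  intro p F hF hFp hp
  exact (hT.upperHemicontinuousAt p.1).mem_of_tendsto (hTclosed _) ((continuous_fst.tendsto p).mono_left hp)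
    (Eventually.frequently (le_principal_iff.1 hFp)) ((continuous_snd.tendsto p).mono_left hp)

theorem isClosed_setOf_succ_mem {T : X → Set X}
    (hG : IsClosed {p : X × X | p.2 ∈ T p.1}) (i : ℤ) :
    IsClosed {x : ℤ → X | x (i + 1) ∈ T (x i)} :=
  hG.preimage (f := fun x : ℤ → X => (x i, x (i + 1)))
    ((continuous_apply i).prodMk (continuous_apply (i + 1)))

theorem isClosed_orbitSpace {T : X → Set X} (hG : IsClosed {p : X × X | p.2 ∈ T p.1}) :
    IsClosed (orbitSpace T) := by
  simp only [orbitSpace, Set.ofPred_forall]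
  exact isClosed_iInter fun i => isClosed_setOf_succ_mem hG i

theorem upperSemicontinuous_timeAverage {f : X → ℝ} (hf : UpperSemicontinuous f) (n : ℕ) :
    UpperSemicontinuous fun x : ℤ → X => timeAverage f x n := by
  have hs : UpperSemicontinuous fun x : ℤ → X => ∑ k ∈ Finset.range (n + 1), f (x (k : ℤ)) :=
    upperSemicontinuous_sum fun k _ => hf.comp (continuous_apply (k : ℤ))
  have hc : Continuous fun t : ℝ => ((1 / ((n : ℝ) + 1) * t : ℝ) : EReal) :=
    continuous_coe_real_ereal.comp (continuous_const.mul continuous_id)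
  refine hc.comp_upperSemicontinuous hs fun a b hab => ?_
  exact EReal.coe_le_coe_iff.2 (mul_le_mul_of_nonneg_left hab (by positivity))

theorem exists_orbit_epsilon_le_timeAverage [CompactSpace X] {T : X → Set X}
    (hG : IsClosed {p : X × X | p.2 ∈ T p.1}) {f : X → ℝ} (hf : UpperSemicontinuous f)
    (hne : (orbitSpace T).Nonempty) :
    ∃ x ∈ orbitSpace T, ∀ n, epsilon T f ≤ timeAverage f x n := by
  have hF : UpperSemicontinuous fun x : ℤ → X => ⨅ n, timeAverage f x n :=
    upperSemicontinuous_iInf fun n => upperSemicontinuous_timeAverage hf n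
  obtain ⟨x, hx, hmax⟩ := (hF.upperSemicontinuousOn _).exists_isMaxOn hne
    (isClosed_orbitSpace hG).isCompact
  exact ⟨x, hx, fun n => (iSup₂_le fun y hy => hmax hy).trans (iInf_le _ n)⟩

end Topology

/-! ### From finite segments to orbits: δ ≤ ε. -/

/-- After a minimum of the partial sums, every further sum is nonnegative. Restricting the minimum
to indices from N on leaves room for a past of length N. -/
theorem exists_partialSums_nonneg {a : ℕ → ℝ} {B : ℝ} (hB : 0 ≤ B) (ha : ∀ j, a j ≤ B) {N n : ℕ}
    (h : (N + (N + 1)) * B < ∑ i ∈ Finset.range (n + 1), a i) :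
    ∃ k, N ≤ k ∧ k + N ≤ n ∧ ∀ m ≤ N + 1, 0 ≤ ∑ i ∈ Finset.range m, a (k + i) := by
  have hsum : ∀ k m, ∑ i ∈ Finset.range m, a (k + i) ≤ m * B := fun k m => by
    simpa using Finset.sum_le_sum fun i (_ : i ∈ Finset.range m) => ha (k + i)
  have hadd : ∀ k m, ∑ i ∈ Finset.range (k + m), a i
      = ∑ i ∈ Finset.range k, a i + ∑ i ∈ Finset.range m, a (k + i) :=
    fun k m => Finset.sum_range_add a k m
  have hle : ∀ m, ∑ i ∈ Finset.range m, a i ≤ m * B := fun m => by simpa using hsum 0 m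
  have hNn : N ≤ n + 1 := by
    by_contra! hlt
    have h1 := hle (n + 1)
    have h2 : ((n + 1 : ℕ) : ℝ) * B ≤ N * B :=
      mul_le_mul_of_nonneg_right (by exact_mod_cast hlt.le) hB
    nlinarith [mul_nonneg (Nat.cast_nonneg (α := ℝ) N) hB]
  obtain ⟨k, hk, hmin⟩ := (Finset.Icc N (n + 1)).exists_min_image
    (fun m => ∑ i ∈ Finset.range m, a i) ⟨N, by simp [hNn]⟩
  rw [Finset.mem_Icc] at hk
  obtain ⟨l, hl⟩ := Nat.exists_eq_add_of_le hk.2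
  have hN := hmin N (by simp [hNn])
  -- A minimizer too close to n + 1 would bound the total by S_N + (N + 1)B ≤ (N + (N + 1))B.
  have hlN : N + 1 < l := by
    by_contra! hlt
    have h1 := hsum k l
    have h2 : (l : ℝ) * B ≤ (N + 1 : ℕ) * B :=
      mul_le_mul_of_nonneg_right (by exact_mod_cast hlt) hB
    have h3 := hle N
    rw [hl, hadd] at h
    push_cast at h2
    nlinarith
  refine ⟨k, hk.1, by omega, fun m hm => ?_⟩
  have := hmin (k + m) (by rw [Finset.mem_Icc]; omega)
  simp only [hadd k m] at this
  linarith

theorem exists_lt_sum_of_lt {X : Type*} {T : X → Set X} {f : X → ℝ} {n : ℕ} {c : ℝ}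
    (h : (c : EReal) < ((1 / ((n : ℝ) + 1) : ℝ) : EReal) *
      ⨆ x ∈ orbitSegments T n, ((∑ k, f (x k) : ℝ) : EReal)) :
    ∃ x ∈ orbitSegments T n, c * (n + 1) < ∑ k, f (x k) := by
  by_contra! hc
  refine absurd h (not_lt.2 ?_)
  have hn : (0 : ℝ) < n + 1 := by positivity
  calc _ ≤ ((1 / ((n : ℝ) + 1) : ℝ) : EReal) * ((c * (n + 1) : ℝ) : EReal) :=
        mul_le_mul_of_nonneg_left (iSup₂_le fun x hx => EReal.coe_le_coe_iff.2 (hc x hx))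
          (EReal.coe_nonneg.2 (by positivity))
    _ = c := by
      rw [← EReal.coe_mul]
      congr 1
      field_simp

theorem exists_centered_segment {X : Type*} {T : X → Set X} {f : X → ℝ} {M : ℝ}
    (hM : ∀ x, f x ≤ M) {c : ℝ} (hc : (c : EReal) < delta T f) (N : ℕ) :
    ∃ y : ℤ → X, (∀ i : ℤ, -N ≤ i → i < N → y (i + 1) ∈ T (y i)) ∧
      ∀ m ≤ N + 1, c * m ≤ ∑ k ∈ Finset.range m, f (y (k : ℤ)) := by
  -- The gap c' - c gives an excess growing linearly in n, which eventually beats the constant (N +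
  -- (N + 1))B.
  obtain ⟨c', hcc', hc'⟩ := EReal.lt_iff_exists_real_btwn.1 hc
  rw [EReal.coe_lt_coe_iff] at hcc'
  set B := max (M - c) 0
  have hlarge : ∀ᶠ n : ℕ in atTop, (N + (N + 1)) * B < (c' - c) * ((n : ℝ) + 1) := by
    have : Tendsto (fun n : ℕ => (c' - c) * ((n : ℝ) + 1)) atTop atTop :=
      (tendsto_atTop_add_const_right _ _ tendsto_natCast_atTop_atTop).const_mul_atTop
        (sub_pos.2 hcc')
    exact this.eventually_gt_atTop _
  obtain ⟨n, hn, hlt⟩ := ((frequently_lt_of_lt_limsup (by isBoundedDefault) hc').and_eventually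
    hlarge).exists
  obtain ⟨x, hx, hsum⟩ := exists_lt_sum_of_lt hn
  -- The last entry is repeated forever; only indices up to n matter.
  let u : ℕ → X := fun j => x (Fin.ofNat (n + 1) (min j n))
  have hu : ∀ j < n, u (j + 1) ∈ T (u j) := fun j hj => by
    have h := hx ⟨j, hj⟩
    have e1 : Fin.ofNat (n + 1) (min (j + 1) n) = Fin.succ ⟨j, hj⟩ := by
      ext; simp [Nat.mod_eq_of_lt, hj]
    have e2 : Fin.ofNat (n + 1) (min j n) = Fin.castSucc ⟨j, hj⟩ := by
      ext; simp [Nat.min_eq_left hj.le]; omega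
    simp only [u, e1, e2]
    exact h
  have hsu : ∑ k, f (x k) = ∑ j ∈ Finset.range (n + 1), f (u j) := by
    rw [Finset.sum_range]
    refine Finset.sum_congr rfl fun k _ => ?_
    congr 2
    ext
    simp [Nat.min_eq_left (Nat.lt_succ_iff.1 k.2)]
  obtain ⟨k, hNk, hkn, hk⟩ := exists_partialSums_nonneg (a := fun j => f (u j) - c) (B := B)
    (N := N) (n := n) (le_max_right _ _)
    (fun j => (sub_le_sub_right (hM _) c).trans (le_max_left _ _)) (by
      rw [Finset.sum_sub_distrib, ← hsu]
      simp only [Finset.sum_const, Finset.card_range, nsmul_eq_mul]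
      push_cast
      nlinarith)
  -- The cut time k becomes time 0; truncation by `toNat` only affects times before -k ≤ -N.
  refine ⟨fun i => u (k + i).toNat, fun i hi hi' => ?_, fun m hm => ?_⟩
  · have : ((k : ℤ) + (i + 1)).toNat = ((k : ℤ) + i).toNat + 1 := by omega
    simp only [this]
    exact hu _ (by omega)
  · have h := hk m hm
    rw [Finset.sum_sub_distrib] at h
    simp only [Finset.sum_const, Finset.card_range, nsmul_eq_mul] at h
    have e : ∀ i : ℕ, ((k : ℤ) + i).toNat = k + i := fun i => by omega
    simp only [e]
    linarith

theorem delta_le_epsilon {X : Type*} [TopologicalSpace X] [CompactSpace X] {T : X → Set X}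
    (hG : IsClosed {p : X × X | p.2 ∈ T p.1}) {f : X → ℝ} (hf : UpperSemicontinuous f)
    {M : ℝ} (hM : ∀ x, f x ≤ M) : delta T f ≤ epsilon T f := by
  refine EReal.ge_of_forall_gt_iff_ge.1 fun c hc => ?_
  let K : ℕ → Set (ℤ → X) := fun N =>
    {y | (∀ i : ℤ, -N ≤ i → i < N → y (i + 1) ∈ T (y i)) ∧
      ∀ m ≤ N + 1, c * m ≤ ∑ k ∈ Finset.range m, f (y (k : ℤ))}
  have hclosed : ∀ N, IsClosed (K N) := fun N => by
    refine IsClosed.inter (s₁ := {y : ℤ → X | ∀ i : ℤ, -N ≤ i → i < N → y (i + 1) ∈ T (y i)})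
      (s₂ := {y : ℤ → X | ∀ m ≤ N + 1, c * m ≤ ∑ k ∈ Finset.range m, f (y (k : ℤ))}) ?_ ?_
    · simp only [Set.ofPred_forall]
      exact isClosed_iInter fun i => isClosed_iInter fun _ => isClosed_iInter fun _ =>
        isClosed_setOf_succ_mem hG i
    · simp only [Set.ofPred_forall]
      refine isClosed_iInter fun m => isClosed_iInter fun _ => ?_
      have hs : UpperSemicontinuous fun y : ℤ → X => ∑ k ∈ Finset.range m, f (y (k : ℤ)) :=
        upperSemicontinuous_sum fun k _ => hf.comp (continuous_apply (k : ℤ))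
      exact hs.isClosed_preimage (c * m)
  obtain ⟨y, hy⟩ := IsCompact.nonempty_iInter_of_sequence_nonempty_isCompact_isClosed K
    -- The sets `K N` decrease, so Cantor's intersection theorem applies.
    (fun N y hy => ⟨fun i h1 h2 => hy.1 i (by push_cast; omega) (by push_cast; omega),
      fun m hm => hy.2 m (by omega)⟩)
    (fun N => exists_centered_segment hM hc N) (hclosed 0).isCompact hclosed
  rw [Set.mem_iInter] at hy
  have hyT : y ∈ orbitSpace T := fun i => (hy (i.natAbs + 1)).1 i (by omega) (by omega)
  refine le_iSup₂_of_le y hyT (le_iInf fun n => EReal.coe_le_coe_iff.2 ?_)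
  have h := (hy n).2 (n + 1) le_rfl
  rw [one_div, inv_mul_eq_div, le_div_iff₀ (by positivity)]
  exact_mod_cast h

/-! ### Comparison of β, γ, δ and ε. -/

theorem epsilon_le_gamma {X : Type*} (T : X → Set X) (f : X → ℝ) : epsilon T f ≤ gamma T f :=
  iSup₂_mono fun _ _ => (iInf_le_liminf).trans (liminf_le_limsup)

theorem gamma_le_delta {X : Type*} (T : X → Set X) (f : X → ℝ) : gamma T f ≤ delta T f := by
  refine iSup₂_le fun x hx => limsup_le_limsup (Eventually.of_forall fun n => ?_)
  have hseg : (fun k : Fin (n + 1) => x ((k : ℕ) : ℤ)) ∈ orbitSegments T n := fun k => by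
    simpa using hx ((k : ℕ) : ℤ)
  simp only [timeAverage, EReal.coe_mul]
  refine mul_le_mul_of_nonneg_left ?_ (EReal.coe_nonneg.2 (by positivity))
  rw [Finset.sum_range]
  exact le_iSup₂_of_le (f := fun (x : Fin (n + 1) → X) (_ : x ∈ orbitSegments T n) =>
    ((∑ k, f (x k) : ℝ) : EReal)) _ hseg le_rfl

theorem beta_le_gamma {X : Type*} (T : X → Set X) (f : X → ℝ) : beta T f ≤ gamma T f := by
  refine sSup_le ?_
  rintro L ⟨x, hx, hL⟩
  exact le_iSup₂_of_le x hx.1 hL.limsup_eq.ge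

/-- An orbit attaining ε has liminf at least ε ≥ γ and limsup at most γ, hence is regular with limit
γ. -/
theorem gamma_le_beta {X : Type*} [TopologicalSpace X] [CompactSpace X] {T : X → Set X}
    (hG : IsClosed {p : X × X | p.2 ∈ T p.1}) {f : X → ℝ} (hf : UpperSemicontinuous f)
    (h : gamma T f ≤ epsilon T f) : gamma T f ≤ beta T f := by
  rcases (orbitSpace T).eq_empty_or_nonempty with he | hne
  · simp [gamma, he]
  obtain ⟨x, hx, hn⟩ := exists_orbit_epsilon_le_timeAverage hG hf hne
  have hL : Tendsto (timeAverage f x) atTop (𝓝 (gamma T f)) :=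
    tendsto_of_le_liminf_of_limsup_le
      (h.trans (le_liminf_of_le (by isBoundedDefault) (Eventually.of_forall hn)))
      (le_iSup₂ (f := fun x (_ : x ∈ orbitSpace T) => limsup (timeAverage f x) atTop) x hx)
  exact le_sSup ⟨x, ⟨hx, _, hL⟩, hL⟩

/-! ### Layer-cake comparisons of integrals. -/

open scoped ENNReal

/-- The layer-cake formula is used for real functions, whereas costs may be ∞; hence the truncation
at n and monotone convergence. -/
theorem lintegral_le_lintegral_of_measure_lt_le {α : Type*} [MeasurableSpace α] {μ : Measure α}
    {g h : α → ℝ≥0∞} (hg : Measurable g) (hh : Measurable h)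
    (H : ∀ t : ℝ, μ {a | ENNReal.ofReal t < g a} ≤ μ {a | ENNReal.ofReal t < h a}) :
    ∫⁻ a, g a ∂μ ≤ ∫⁻ a, h a ∂μ := by
  have htrunc : ∀ {u : α → ℝ≥0∞}, Measurable u → ∀ n : ℕ,
      ∫⁻ a, min (u a) n ∂μ = ∫⁻ t in Set.Ioi (0 : ℝ),
        μ ({a | ENNReal.ofReal t < u a} ∩ {_a | ENNReal.ofReal t < n}) := by
    intro u hu n
    have hfin : ∀ a, min (u a) (n : ℝ≥0∞) ≠ ∞ := fun a =>
      ((min_le_right _ _).trans_lt (ENNReal.natCast_lt_top n)).ne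
    have hlayer := lintegral_eq_lintegral_meas_lt μ
      (f := fun a => (min (u a) (n : ℝ≥0∞)).toReal)
      (Eventually.of_forall fun a => ENNReal.toReal_nonneg)
      (hu.min measurable_const).ennreal_toReal.aemeasurable
    simp only [ENNReal.ofReal_toReal (hfin _)] at hlayer
    rw [hlayer]
    refine setLIntegral_congr_fun measurableSet_Ioi fun t ht => ?_
    congr 1
    ext a
    simp [← ENNReal.ofReal_lt_iff_lt_toReal (le_of_lt ht) (hfin a)]
  have hsup : ∫⁻ a, g a ∂μ = ⨆ n : ℕ, ∫⁻ a, min (g a) n ∂μ := by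
    rw [← lintegral_iSup (fun n => hg.min measurable_const)
      (fun m n hmn a => min_le_min_left _ (by exact_mod_cast hmn))]
    refine lintegral_congr fun a => ?_
    rw [← inf_iSup_eq, ENNReal.iSup_natCast, inf_top_eq]
  rw [hsup]
  refine iSup_le fun n => ?_
  calc ∫⁻ a, min (g a) n ∂μ ≤ ∫⁻ a, min (h a) n ∂μ := by
        rw [htrunc hg, htrunc hh]
        refine lintegral_mono fun t => ?_
        by_cases ht : ENNReal.ofReal t < n
        · simpa [ht] using H t
        · simp [ht]
    _ ≤ _ := lintegral_mono fun a => min_le_left _ _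

/-- Superlevel sets of g are open: apply the hypothesis levelwise, then Fatou's lemma in the level
t. -/
theorem lintegral_ofReal_le_liminf_of_lowerSemicontinuous {Ω : Type*} [MeasurableSpace Ω]
    [TopologicalSpace Ω] [OpensMeasurableSpace Ω] {μ : Measure Ω} {μs : ℕ → Measure Ω}
    {g : Ω → ℝ} (hg : LowerSemicontinuous g) (hg0 : 0 ≤ g)
    (hopen : ∀ G, IsOpen G → μ G ≤ liminf (fun i => μs i G) atTop) :
    ∫⁻ x, ENNReal.ofReal (g x) ∂μ ≤ liminf (fun i => ∫⁻ x, ENNReal.ofReal (g x) ∂(μs i)) atTop := by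
  simp_rw [lintegral_eq_lintegral_meas_lt _ (Eventually.of_forall hg0) hg.measurable.aemeasurable]
  exact (lintegral_mono fun t => hopen _ (hg.isOpen_preimage t)).trans
    (lintegral_liminf_le fun n => Antitone.measurable fun s t hst =>
      measure_mono fun ω hω => lt_of_le_of_lt hst hω)

theorem mem_preimage {X : Type*} {T : X → Set X} {A : Set X} {x : X} :
    x ∈ preimage T A ↔ ∃ y ∈ T x, y ∈ A := by
  simp [preimage, and_comm]

/-! ### Optimal costs and invariance: α ≤ δ. -/

section Cost

variable {X : Type*}

/-- The infimum of the total cost `h (x_0) + ⋯ + h (x_n)` over the orbit segments of length `n`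
that start at a given point. -/
noncomputable def minCost (T : X → Set X) (h : X → ℝ≥0∞) : ℕ → X → ℝ≥0∞
  | 0 => h
  | n + 1 => fun x => h x + ⨅ y ∈ T x, minCost T h n y

theorem exists_segment_of_minCost_lt {T : X → Set X} {h : X → ℝ≥0∞} {n : ℕ} :
    ∀ {x : X} {a : ℝ≥0∞}, minCost T h n x < a →
      ∃ s ∈ orbitSegments T n, s 0 = x ∧ ∑ k, h (s k) < a := by
  induction n with
  | zero =>
    intro x a ha
    exact ⟨fun _ => x, fun k => k.elim0, rfl, by simpa [minCost] using ha⟩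
  | succ n ih =>
    intro x a ha
    obtain ⟨y, hy, hlt⟩ : ∃ y ∈ T x, minCost T h n y < a - h x := by
      by_contra! hc
      exact absurd ha (not_lt.2 (tsub_le_iff_left.1 (le_iInf₂ hc)))
    obtain ⟨s, hs, hs0, hsum⟩ := ih hlt
    refine ⟨Fin.cons x s, fun k => ?_, rfl, ?_⟩
    · refine Fin.cases ?_ (fun j => ?_) k
      · simpa [hs0] using hy
      · simpa [← Fin.succ_castSucc] using hs j
    · rw [Fin.sum_univ_succ]
      simpa using lt_tsub_iff_left.1 hsum

variable [TopologicalSpace X] [CompactSpace X]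

theorem isClosed_preimage {T : X → Set X} (hG : IsClosed {p : X × X | p.2 ∈ T p.1})
    {A : Set X} (hA : IsClosed A) : IsClosed (preimage T A) := by
  have : preimage T A = Prod.fst '' ({p : X × X | p.2 ∈ T p.1} ∩ Prod.snd ⁻¹' A) := by
    ext x
    simp [mem_preimage]
  rw [this]
  exact isClosedMap_fst_of_compactSpace _ (hG.inter (hA.preimage continuous_snd))

/-- The infimum over a nonempty compact `T x` is attained. Over an empty `T x` it is ∞, which is why
t must be finite. -/
theorem setOf_iInf_le_eq_preimage {T : X → Set X} (hT : ∀ x, IsClosed (T x)) {C : X → ℝ≥0∞}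
    (hC : LowerSemicontinuous C) {t : ℝ≥0∞} (ht : t ≠ ∞) :
    {x | ⨅ y ∈ T x, C y ≤ t} = preimage T {y | C y ≤ t} := by
  ext x
  rw [mem_preimage]
  refine ⟨fun hx => ?_, fun ⟨y, hy, hyt⟩ =>
    (iInf₂_le (f := fun y (_ : y ∈ T x) => C y) y hy).trans hyt⟩
  rcases (T x).eq_empty_or_nonempty with he | hne
  · simp [he, ht] at hx
  · obtain ⟨y, hy, hmin⟩ := (hC.lowerSemicontinuousOn (T x)).exists_isMinOn hne (hT x).isCompact
    have hle : C y ≤ ⨅ z ∈ T x, C z := le_iInf₂ fun z hz => hmin hz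
    exact ⟨y, hy, hle.trans hx⟩

theorem lowerSemicontinuous_iInf_mem {T : X → Set X} (hG : IsClosed {p : X × X | p.2 ∈ T p.1})
    (hT : ∀ x, IsClosed (T x)) {C : X → ℝ≥0∞} (hC : LowerSemicontinuous C) :
    LowerSemicontinuous fun x => ⨅ y ∈ T x, C y := by
  rw [lowerSemicontinuous_iff_isClosed_preimage]
  intro t
  rcases eq_or_ne t ∞ with rfl | ht
  · simp
  · have h := isClosed_preimage hG (hC.isClosed_preimage t)
    have he : (fun x => ⨅ y ∈ T x, C y) ⁻¹' Set.Iic t = preimage T (C ⁻¹' Set.Iic t) :=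
      setOf_iInf_le_eq_preimage hT hC ht
    rwa [he]

theorem lowerSemicontinuous_minCost {T : X → Set X} (hG : IsClosed {p : X × X | p.2 ∈ T p.1})
    (hT : ∀ x, IsClosed (T x)) {h : X → ℝ≥0∞} (hh : LowerSemicontinuous h) (n : ℕ) :
    LowerSemicontinuous (minCost T h n) := by
  induction n with
  | zero => exact hh
  | succ n ih => exact hh.add (lowerSemicontinuous_iInf_mem hG hT ih)

variable [MeasurableSpace X] [BorelSpace X]

/-- Invariance applied to the sublevel sets of `C`, whose preimages are the sublevel sets of the
infimum; complements turn this into a comparison of superlevel sets. -/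
theorem lintegral_iInf_mem_le {T : X → Set X} (hG : IsClosed {p : X × X | p.2 ∈ T p.1})
    (hT : ∀ x, IsClosed (T x)) {μ : Measure X} [IsProbabilityMeasure μ] (hμ : IsInvariant T μ)
    {C : X → ℝ≥0∞} (hC : LowerSemicontinuous C) :
    ∫⁻ x, ⨅ y ∈ T x, C y ∂μ ≤ ∫⁻ x, C x ∂μ := by
  have hP := lowerSemicontinuous_iInf_mem hG hT hC
  refine lintegral_le_lintegral_of_measure_lt_le hP.measurable hC.measurable fun t => ?_
  have h1 := hμ _ (hC.isClosed_preimage (ENNReal.ofReal t)).measurableSet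
  have h2 := setOf_iInf_le_eq_preimage hT hC (t := ENNReal.ofReal t) ENNReal.ofReal_ne_top
  have hcompl : ∀ {u : X → ℝ≥0∞}, LowerSemicontinuous u →
      μ {a | ENNReal.ofReal t < u a} = 1 - μ {a | u a ≤ ENNReal.ofReal t} := fun {u} hu => by
    have hm : MeasurableSet {a | u a ≤ ENNReal.ofReal t} :=
      (hu.isClosed_preimage (ENNReal.ofReal t)).measurableSet
    rw [← prob_compl_eq_one_sub hm]
    congr 1
    ext a
    simp
  rw [hcompl hP, hcompl hC, h2]
  exact tsub_le_tsub_left h1 _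

theorem lintegral_minCost_le {T : X → Set X} (hG : IsClosed {p : X × X | p.2 ∈ T p.1})
    (hT : ∀ x, IsClosed (T x)) {μ : Measure X} [IsProbabilityMeasure μ] (hμ : IsInvariant T μ)
    {h : X → ℝ≥0∞} (hh : LowerSemicontinuous h) (n : ℕ) :
    ∫⁻ x, minCost T h n x ∂μ ≤ (n + 1) * ∫⁻ x, h x ∂μ := by
  induction n with
  | zero => simp [minCost]
  | succ n ih =>
    have hn := lowerSemicontinuous_minCost hG hT hh n
    calc ∫⁻ x, minCost T h (n + 1) x ∂μ
        = ∫⁻ x, h x ∂μ + ∫⁻ x, ⨅ y ∈ T x, minCost T h n y ∂μ :=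
          lintegral_add_left hh.measurable _
      _ ≤ ∫⁻ x, h x ∂μ + (n + 1) * ∫⁻ x, h x ∂μ := by
          gcongr
          exact (lintegral_iInf_mem_le hG hT hμ hn).trans ih
      _ = _ := by push_cast; ring

end Cost

/-- Integrate (M - f) + f⁺ = M + f⁻. The cost M - f is nonnegative, so a single integral in [0, ∞]
replaces the difference of two. -/
theorem extIntegral_eq_sub {X : Type*} [MeasurableSpace X] {f : X → ℝ} (hf : Measurable f)
    {M : ℝ} (hM0 : 0 ≤ M) (hM : ∀ x, f x ≤ M) (μ : Measure X) [IsProbabilityMeasure μ] :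
    extIntegral f μ = (M : EReal) - ((∫⁻ x, ENNReal.ofReal (M - f x) ∂μ : ℝ≥0∞) : EReal) := by
  have hp : ∫⁻ x, ENNReal.ofReal (f x) ∂μ ≠ ∞ := by
    have : ∫⁻ x, ENNReal.ofReal (f x) ∂μ ≤ ∫⁻ _, ENNReal.ofReal M ∂μ :=
      lintegral_mono fun x => ENNReal.ofReal_le_ofReal (hM x)
    exact (this.trans_lt (by simp)).ne
  have key : ∫⁻ x, ENNReal.ofReal (M - f x) ∂μ + ∫⁻ x, ENNReal.ofReal (f x) ∂μ
      = ENNReal.ofReal M + ∫⁻ x, ENNReal.ofReal (-f x) ∂μ := by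
    have hc : ENNReal.ofReal M = ∫⁻ _, ENNReal.ofReal M ∂μ := by simp
    rw [hc, ← lintegral_add_right _ hf.ennreal_ofReal, ← lintegral_add_left measurable_const]
    refine lintegral_congr fun x => ?_
    rcases le_total 0 (f x) with h | h
    · rw [← ENNReal.ofReal_add (sub_nonneg.2 (hM x)) h,
        ENNReal.ofReal_of_nonpos (p := -f x) (by linarith)]
      simp
    · rw [ENNReal.ofReal_of_nonpos h, ← ENNReal.ofReal_add hM0 (neg_nonneg.2 h)]
      simp [sub_eq_add_neg]
  unfold extIntegral
  generalize ∫⁻ x, ENNReal.ofReal (f x) ∂μ = p at *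
  generalize ∫⁻ x, ENNReal.ofReal (-f x) ∂μ = q at *
  generalize ∫⁻ x, ENNReal.ofReal (M - f x) ∂μ = a at *
  rcases eq_or_ne q ∞ with rfl | hq
  · have ha : a = ∞ := by simpa [hp] using key
    simp [ha, EReal.sub_top]
  · have ha : a ≠ ∞ := fun ha => by
      rw [ha, top_add] at key
      exact ENNReal.add_ne_top.2 ⟨ENNReal.ofReal_ne_top, hq⟩ key.symm
    have hr := congrArg ENNReal.toReal key
    rw [ENNReal.toReal_add ha hp, ENNReal.toReal_add ENNReal.ofReal_ne_top hq,
      ENNReal.toReal_ofReal hM0] at hr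
    rw [← EReal.coe_ennreal_toReal hp, ← EReal.coe_ennreal_toReal hq,
      ← EReal.coe_ennreal_toReal ha, ← EReal.coe_sub, ← EReal.coe_sub, EReal.coe_eq_coe_iff]
    linarith

theorem lintegral_lt_of_lt_extIntegral {X : Type*} [MeasurableSpace X] {f : X → ℝ}
    (hf : Measurable f) {M : ℝ} (hM0 : 0 ≤ M) (hM : ∀ x, f x ≤ M) (μ : Measure X)
    [IsProbabilityMeasure μ] {c : ℝ} (hc : (c : EReal) < extIntegral f μ) :
    ∫⁻ x, ENNReal.ofReal (M - f x) ∂μ < ENNReal.ofReal (M - c) := by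
  rw [extIntegral_eq_sub hf hM0 hM] at hc
  generalize ∫⁻ x, ENNReal.ofReal (M - f x) ∂μ = a at *
  rcases eq_or_ne a ∞ with rfl | ha
  · simp [EReal.sub_top] at hc
  · rw [← EReal.coe_ennreal_toReal ha, ← EReal.coe_sub, EReal.coe_lt_coe_iff] at hc
    rw [ENNReal.lt_ofReal_iff_toReal_lt ha]
    linarith

theorem le_extIntegral_of_lintegral_le {X : Type*} [MeasurableSpace X] {f : X → ℝ}
    (hf : Measurable f) {M : ℝ} (hM0 : 0 ≤ M) (hM : ∀ x, f x ≤ M) (μ : Measure X)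
    [IsProbabilityMeasure μ] {c : ℝ} (hcM : c ≤ M)
    (hc : ∫⁻ x, ENNReal.ofReal (M - f x) ∂μ ≤ ENNReal.ofReal (M - c)) :
    (c : EReal) ≤ extIntegral f μ := by
  rw [extIntegral_eq_sub hf hM0 hM]
  generalize ∫⁻ x, ENNReal.ofReal (M - f x) ∂μ = a at *
  have ha : a ≠ ∞ := (hc.trans_lt ENNReal.ofReal_lt_top).ne
  rw [← EReal.coe_ennreal_toReal ha, ← EReal.coe_sub, EReal.coe_le_coe_iff]
  have := ENNReal.toReal_le_of_le_ofReal (sub_nonneg.2 hcM) hc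
  linarith

theorem alpha_le_delta {X : Type*} [TopologicalSpace X] [CompactSpace X] [MeasurableSpace X]
    [BorelSpace X] {T : X → Set X} (hG : IsClosed {p : X × X | p.2 ∈ T p.1})
    (hT : ∀ x, IsClosed (T x)) {f : X → ℝ} (hf : UpperSemicontinuous f) {M : ℝ} (hM0 : 0 ≤ M)
    (hM : ∀ x, f x ≤ M) : alpha T f ≤ delta T f := by
  refine iSup₂_le fun μ hμ => EReal.ge_of_forall_gt_iff_ge.1 fun c hc => ?_
  have hI := lintegral_lt_of_lt_extIntegral hf.measurable hM0 hM (μ : Measure X) hc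
  set h : X → ℝ≥0∞ := fun x => ENNReal.ofReal (M - f x) with hdef
  have hh : LowerSemicontinuous h :=
    Continuous.comp_upperSemicontinuous_antitone
      (g := fun t : ℝ => ENNReal.ofReal (M - t))
      (ENNReal.continuous_ofReal.comp (continuous_const.sub continuous_id)) hf
      fun a b hab => ENNReal.ofReal_le_ofReal (by linarith)
  refine le_limsup_of_frequently_le (Frequently.of_forall fun n => ?_) (by isBoundedDefault)
  have hn0 : (0 : ℝ) < (n : ℝ) + 1 := by positivity
  have hint : ∫⁻ x, minCost T h n x ∂(μ : Measure X) < ENNReal.ofReal ((n + 1) * (M - c)) := by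
    refine (lintegral_minCost_le hG hT hμ hh n).trans_lt ?_
    rw [ENNReal.ofReal_mul hn0.le]
    have : ENNReal.ofReal ((n : ℝ) + 1) = (n : ℝ≥0∞) + 1 := by
      rw [ENNReal.ofReal_add (by positivity) zero_le_one]
      simp
    rw [this]
    exact ENNReal.mul_lt_mul_right (by simp) (by finiteness) hI
  -- Some point has optimal cost at most the mean, and a segment starting there realizes the strict
  -- bound.
  obtain ⟨x, hx⟩ := exists_le_lintegral
    (lowerSemicontinuous_minCost hG hT hh n).measurable.aemeasurable (μ := (μ : Measure X))
  obtain ⟨s, hs, -, hsum⟩ := exists_segment_of_minCost_lt (hx.trans_lt hint)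
  have hsum' : c * (n + 1) ≤ ∑ k, f (s k) := by
    rw [hdef, ← ENNReal.ofReal_sum_of_nonneg fun k _ => sub_nonneg.2 (hM (s k))] at hsum
    have := (ENNReal.ofReal_lt_ofReal_iff_of_nonneg
      (Finset.sum_nonneg fun k _ => sub_nonneg.2 (hM (s k)))).1 hsum
    rw [Finset.sum_sub_distrib] at this
    simp at this
    linarith
  calc (c : EReal) = ((1 / ((n : ℝ) + 1) : ℝ) : EReal) * ((c * (n + 1) : ℝ) : EReal) := by
        rw [← EReal.coe_mul]
        congr 1
        field_simp
    _ ≤ _ := mul_le_mul_of_nonneg_left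
        (le_iSup₂_of_le (f := fun (x : Fin (n + 1) → X) (_ : x ∈ orbitSegments T n) =>
          ((∑ k, f (x k) : ℝ) : EReal)) s hs (EReal.coe_le_coe_iff.2 hsum'))
        (EReal.coe_nonneg.2 (by positivity))

/-! ### Empirical measures and invariant limits: ε ≤ α. -/

section Empirical

variable {Y : Type*} [MeasurableSpace Y]

/-- The empirical measure `(δ_{z_0} + ⋯ + δ_{z_n}) / (n + 1)` of a sequence. -/
noncomputable def empiricalMeasure (z : ℕ → Y) (n : ℕ) : Measure Y :=
  ((n : ℝ≥0∞) + 1)⁻¹ • ∑ k ∈ Finset.range (n + 1), Measure.dirac (z k)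

theorem lintegral_empiricalMeasure (z : ℕ → Y) (n : ℕ) {g : Y → ℝ≥0∞} (hg : Measurable g) :
    ∫⁻ y, g y ∂(empiricalMeasure z n)
      = ((n : ℝ≥0∞) + 1)⁻¹ * ∑ k ∈ Finset.range (n + 1), g (z k) := by
  simp [empiricalMeasure, lintegral_smul_measure, lintegral_dirac' _ hg]

instance isProbabilityMeasure_empiricalMeasure (z : ℕ → Y) (n : ℕ) :
    IsProbabilityMeasure (empiricalMeasure z n) := by
  constructor
  rw [← lintegral_one, lintegral_empiricalMeasure z n measurable_const]
  simp only [Finset.sum_const, Finset.card_range, nsmul_eq_mul, mul_one]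
  push_cast
  exact ENNReal.inv_mul_cancel (by simp) (by finiteness)

theorem empiricalMeasure_eq_zero {z : ℕ → Y} {S : Set Y} (hS : MeasurableSet S)
    (hz : ∀ k, z k ∉ S) (n : ℕ) : empiricalMeasure z n S = 0 := by
  rw [← lintegral_indicator_one hS, lintegral_empiricalMeasure z n
    (measurable_one.indicator hS)]
  simp [hz]

theorem integral_empiricalMeasure [TopologicalSpace Y] [OpensMeasurableSpace Y] (z : ℕ → Y)
    (n : ℕ) (g : BoundedContinuousFunction Y ℝ) :
    ∫ y, g y ∂(empiricalMeasure z n)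
      = ((n : ℝ) + 1)⁻¹ * ∑ k ∈ Finset.range (n + 1), g (z k) := by
  have hd : ∀ y : Y, ∫ w, g w ∂(Measure.dirac y) = g y := fun y =>
    integral_dirac' _ _ g.continuous.stronglyMeasurable
  rw [empiricalMeasure, integral_smul_measure,
    integral_finsetSum_measure fun k _ => g.integrable _]
  simp only [hd, smul_eq_mul, ENNReal.toReal_inv]
  congr 2

end Empirical

/-- Almost surely, a second coordinate in A puts the first in T⁻¹A. As T⁻¹A need not be measurable,
the argument passes through its measurable hull. -/
theorem isInvariant_map_fst {X : Type*} [MeasurableSpace X] {T : X → Set X} {ν : Measure (X × X)}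
    (hmarg : ν.map Prod.fst = ν.map Prod.snd) (hgraph : ∀ᵐ p ∂ν, p.2 ∈ T p.1) :
    IsInvariant T (ν.map Prod.fst) := by
  intro A hA
  set μ := ν.map Prod.fst
  calc μ A = ν (Prod.snd ⁻¹' A) := by rw [hmarg, Measure.map_apply measurable_snd hA]
    _ ≤ ν (Prod.fst ⁻¹' toMeasurable μ (preimage T A)) := by
      refine measure_mono_ae ?_
      filter_upwards [hgraph] with p hp hpA
      exact subset_toMeasurable μ _ (mem_preimage.2 ⟨p.2, hp, hpA⟩)
    _ = μ (toMeasurable μ (preimage T A)) :=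
      (Measure.map_apply measurable_fst (measurableSet_toMeasurable _ _)).symm
    _ = μ (preimage T A) := measure_toMeasurable _

variable {X : Type*} [TopologicalSpace X] [CompactSpace X] [TopologicalSpace.MetrizableSpace X]
  [MeasurableSpace X] [BorelSpace X]

theorem exists_isInvariant_le_extIntegral {T : X → Set X}
    (hG : IsClosed {p : X × X | p.2 ∈ T p.1}) {f : X → ℝ} (hf : UpperSemicontinuous f) {M : ℝ}
    (hM0 : 0 ≤ M) (hM : ∀ x, f x ≤ M) {x : ℤ → X} (hx : x ∈ orbitSpace T) {c : ℝ}
    (hc : ∀ n, (c : EReal) ≤ timeAverage f x n) :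
    ∃ μ ∈ invariantMeasures T, (c : EReal) ≤ extIntegral f (μ : Measure X) := by
  -- Second countability makes the product σ-algebra on `X × X` the Borel one.
  have : SecondCountableTopology X := by
    let := TopologicalSpace.metrizableSpaceMetric X
    infer_instance
  let z : ℕ → X × X := fun k => (x k, x (k + 1))
  let E : ℕ → ProbabilityMeasure (X × X) := fun n => ⟨empiricalMeasure z n, inferInstance⟩
  obtain ⟨ν, φ, hφ, hlim⟩ := CompactSpace.tendsto_subseq E
  have hopen : ∀ G : Set (X × X), IsOpen G →
      (ν : Measure (X × X)) G ≤ liminf (fun i => empiricalMeasure z (φ i) G) atTop :=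
    fun G hGo => ProbabilityMeasure.le_liminf_measure_open_of_tendsto hlim hGo
  have hgraph : ∀ᵐ p ∂(ν : Measure (X × X)), p.2 ∈ T p.1 := by
    have h := hopen _ hG.isOpen_compl
    have h0 : ∀ n, empiricalMeasure z n {p : X × X | p.2 ∈ T p.1}ᶜ = 0 := fun n =>
      empiricalMeasure_eq_zero hG.measurableSet.compl
        (fun k hk => hk (hx k)) n
    simp only [h0, liminf_const] at h
    exact le_antisymm h bot_le
  have hmarg : (ν : Measure (X × X)).map Prod.fst = (ν : Measure (X × X)).map Prod.snd := by
    have := Measure.isProbabilityMeasure_map (μ := (ν : Measure (X × X)))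
      measurable_fst.aemeasurable
    have := Measure.isProbabilityMeasure_map (μ := (ν : Measure (X × X)))
      measurable_snd.aemeasurable
    refine ext_of_forall_integral_eq_of_IsFiniteMeasure fun g => ?_
    rw [integral_map measurable_fst.aemeasurable g.continuous.aestronglyMeasurable,
      integral_map measurable_snd.aemeasurable g.continuous.aestronglyMeasurable]
    let g₁ := g.compContinuous ⟨Prod.fst, continuous_fst (X := X) (Y := X)⟩
    let g₂ := g.compContinuous ⟨Prod.snd, continuous_snd (X := X) (Y := X)⟩
    have h1 := (ProbabilityMeasure.tendsto_iff_forall_integral_tendsto.1 hlim) (g₁ - g₂)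
    -- The sum of g(x_k) - g(x_{k+1}) telescopes, so the integral is at most 2‖g‖/(n + 1) in norm,
    -- with n = φ(i) along the subsequence.
    have h2 : Tendsto (fun n => ∫ p, (g₁ - g₂) p ∂(empiricalMeasure z (φ n))) atTop (𝓝 0) := by
      have hdecay : Tendsto (fun n : ℕ => ((n : ℝ) + 1)⁻¹ * (2 * ‖g‖)) atTop (𝓝 0) := by
        simpa [one_div] using
          (tendsto_one_div_add_atTop_nhds_zero_nat (𝕜 := ℝ)).mul_const (2 * ‖g‖)
      refine squeeze_zero_norm (fun n => ?_) (hdecay.comp hφ.tendsto_atTop)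
      have htel : ∑ k ∈ Finset.range (φ n + 1), (g₁ - g₂) (z k)
          = g (x 0) - g (x ((φ n + 1 : ℕ) : ℤ)) := by
        rw [← Int.natCast_zero, ← Finset.sum_range_sub' (fun k : ℕ => g (x k))]
        refine Finset.sum_congr rfl fun k _ => ?_
        simp [g₁, g₂, z]
      rw [integral_empiricalMeasure, htel, norm_mul, norm_inv, Function.comp_apply,
        Real.norm_of_nonneg (by positivity : (0 : ℝ) ≤ (φ n : ℝ) + 1)]
      gcongr
      refine (norm_sub_le _ _).trans ?_
      linarith [g.norm_coe_le_norm (x 0), g.norm_coe_le_norm (x ((φ n + 1 : ℕ) : ℤ))]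
    have h3 := tendsto_nhds_unique h1 h2
    simp only [BoundedContinuousFunction.coe_sub, Pi.sub_apply] at h3
    rw [integral_sub (g₁.integrable _) (g₂.integrable _)] at h3
    exact sub_eq_zero.1 h3
  refine ⟨ν.map measurable_fst.aemeasurable, isInvariant_map_fst hmarg hgraph, ?_⟩
  have hcM : c ≤ M := by
    have h := hc 0
    simp only [timeAverage, EReal.coe_le_coe_iff] at h
    simp at h
    exact h.trans (hM _)
  refine le_extIntegral_of_lintegral_le hf.measurable hM0 hM _ hcM ?_
  rw [ProbabilityMeasure.toMeasure_map,
    lintegral_map (hf.measurable.const_sub M).ennreal_ofReal measurable_fst]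
  have hlsc : LowerSemicontinuous fun p : X × X => M - f p.1 :=
    Continuous.comp_upperSemicontinuous_antitone (g := fun t : ℝ => M - t) (by fun_prop)
      (hf.comp continuous_fst) fun a b hab => sub_le_sub_left hab M
  refine (lintegral_ofReal_le_liminf_of_lowerSemicontinuous hlsc
    (fun p => sub_nonneg.2 (hM p.1)) hopen).trans ?_
  refine liminf_le_of_frequently_le' (Frequently.of_forall fun i => ?_)
  rw [lintegral_empiricalMeasure _ _ hlsc.measurable.ennreal_ofReal,
    ← ENNReal.ofReal_sum_of_nonneg fun k _ => sub_nonneg.2 (hM (z k).1)]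
  generalize φ i = n
  have hn0 : (0 : ℝ) < (n : ℝ) + 1 := by positivity
  have hcast : ((n : ℝ≥0∞) + 1) = ENNReal.ofReal ((n : ℝ) + 1) := by
    rw [ENNReal.ofReal_add (by positivity) zero_le_one]
    simp
  rw [hcast, ← ENNReal.ofReal_inv_of_pos hn0, ← ENNReal.ofReal_mul (by positivity)]
  refine ENNReal.ofReal_le_ofReal ?_
  have h := hc n
  rw [timeAverage, EReal.coe_le_coe_iff, one_div, inv_mul_eq_div, le_div_iff₀ hn0] at h
  rw [inv_mul_eq_div, div_le_iff₀ hn0, Finset.sum_sub_distrib]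
  simp only [Finset.sum_const, Finset.card_range, nsmul_eq_mul]
  push_cast
  simp only [z]
  linarith

theorem epsilon_le_alpha {T : X → Set X} (hG : IsClosed {p : X × X | p.2 ∈ T p.1}) {f : X → ℝ}
    (hf : UpperSemicontinuous f) {M : ℝ} (hM0 : 0 ≤ M) (hM : ∀ x, f x ≤ M) :
    epsilon T f ≤ alpha T f := by
  refine EReal.ge_of_forall_gt_iff_ge.1 fun c hc => ?_
  obtain ⟨x, hx, hlt⟩ : ∃ x ∈ orbitSpace T, (c : EReal) < ⨅ n, timeAverage f x n := by
    simpa [epsilon, lt_iSup_iff] using hc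
  obtain ⟨μ, hμ, hle⟩ := exists_isInvariant_le_extIntegral hG hf hM0 hM hx
    fun n => hlt.le.trans (iInf_le _ n)
  exact hle.trans (le_iSup₂ (f := fun (μ : ProbabilityMeasure X) (_ : μ ∈ invariantMeasures T) =>
    extIntegral f (μ : Measure X)) μ hμ)

/-! ### Finiteness bounds and conclusion. -/

theorem epsilon_le_coe {X : Type*} (T : X → Set X) {f : X → ℝ} {M : ℝ} (hM : ∀ x, f x ≤ M) :
    epsilon T f ≤ (M : EReal) := by
  refine iSup₂_le fun x _ => (iInf_le _ 0).trans (EReal.coe_le_coe_iff.2 ?_)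
  simpa using hM (x 0)

theorem coe_le_epsilon {X : Type*} {T : X → Set X} {f : X → ℝ} {m : ℝ} (hm : ∀ x, m ≤ f x)
    (hne : (orbitSpace T).Nonempty) : (m : EReal) ≤ epsilon T f := by
  obtain ⟨x, hx⟩ := hne
  refine le_iSup₂_of_le x hx (le_iInf fun n => EReal.coe_le_coe_iff.2 ?_)
  rw [one_div, inv_mul_eq_div, le_div_iff₀ (by positivity)]
  have := Finset.sum_le_sum fun k (_ : k ∈ Finset.range (n + 1)) => hm (x (k : ℤ))
  simp at this
  linarith

end MultiValued

theorem mainTheorem3 {X : Type*} [TopologicalSpace X] [CompactSpace X]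
    [TopologicalSpace.MetrizableSpace X] [MeasurableSpace X] [BorelSpace X]
    (T : X → Set X) (hT : UpperHemicontinuous T) (hTclosed : ∀ x, IsClosed (T x))
    (f : X → ℝ) (hf : UpperSemicontinuous f) :
    (MultiValued.alpha T f = MultiValued.beta T f ∧
      MultiValued.beta T f = MultiValued.gamma T f ∧
      MultiValued.gamma T f = MultiValued.delta T f ∧
      MultiValued.delta T f = MultiValued.epsilon T f ∧
      MultiValued.alpha T f < ⊤) ∧
    ((MultiValued.orbitSpace T).Nonempty → (∃ C : ℝ, ∀ x, |f x| ≤ C) →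
      ∃ r : ℝ, MultiValued.alpha T f = (r : EReal)) := by
  have hG := MultiValued.isClosed_graph hT hTclosed
  obtain ⟨M, hM0, hM⟩ : ∃ M : ℝ, 0 ≤ M ∧ ∀ x, f x ≤ M := by
    obtain ⟨M, hM⟩ := (hf.upperSemicontinuousOn Set.univ).bddAbove_of_isCompact isCompact_univ
    exact ⟨max M 0, le_max_right _ _, fun x => (hM ⟨x, trivial, rfl⟩).trans (le_max_left _ _)⟩
  have hδε := MultiValued.delta_le_epsilon hG hf hM
  have hεγ := MultiValued.epsilon_le_gamma T f
  have hγδ := MultiValued.gamma_le_delta T f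
  have hβγ := MultiValued.beta_le_gamma T f
  have hγβ := MultiValued.gamma_le_beta hG hf (hγδ.trans hδε)
  have hαδ := MultiValued.alpha_le_delta hG hTclosed hf hM0 hM
  have hεα := MultiValued.epsilon_le_alpha hG hf hM0 hM
  have hαε : MultiValued.alpha T f = MultiValued.epsilon T f := (hαδ.trans hδε).antisymm hεα
  have htop : MultiValued.alpha T f < ⊤ :=
    hαε ▸ (MultiValued.epsilon_le_coe T hM).trans_lt (EReal.coe_lt_top M)
  refine ⟨⟨(hαδ.trans (hδε.trans (hεγ.trans hγβ))).antisymm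
    (hβγ.trans (hγδ.trans (hδε.trans hεα))), hβγ.antisymm hγβ,
    hγδ.antisymm (hδε.trans hεγ), hδε.antisymm (hεγ.trans hγδ), htop⟩, ?_⟩
  rintro hne ⟨C, hC⟩
  have hbot : (⊥ : EReal) < MultiValued.alpha T f :=
    hαε ▸ (EReal.bot_lt_coe (-C)).trans_le
      (MultiValued.coe_le_epsilon (fun x => neg_le_of_abs_le (hC x)) hne)
  exact ⟨_, (EReal.coe_toReal htop.ne hbot.ne').symm⟩
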